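/- Let $\Bbbk$ be a field of characteristic zero and let $W_+$ be the positive Witt algebra over $\Bbbk$, that is, the Lie algebra with basis $\{e_n : n \in \mathbb{Z}_{\ge 1}\}$ and bracket $[e_i, e_j] = (j-i)e_{i+j}$. Let $\mathrm{U}(W_+)$ be its universal enveloping algebra, and let $\mathrm{S}^2(W_+)$ be the degree-two part of the symmetric algebra $\mathrm{S}(W_+)$, regarded as a $\mathrm{U}(W_+)$-module through the action of $W_+$ on $\mathrm{S}(W_+)$ by derivations extending the adjoint action. For a module $M$ over a $\Bbbk$-algebra $A$, the Gelfand–Kirillov dimension is $$\operatorname{GKdim} M = \sup_{V, F}\ \limsup_{n \to \infty}\ \log_n \dim_{\Bbbk}\bigl((\Bbbk + V)^n F\bigr),$$ where $V$ and $F$ range over the finite-dimensional subspaces of $A$ and of $M$ (and the zero module is given dimension $0$). The module $M$ is called GK $d$-critical if $\operatorname{GKdim} M = d$ and $\operatorname{GKdim}(M/N) < d$ for every nonzero submodule $N$ of $M$. Then, as a $\mathrm{U}(W_+)$-module, $\mathrm{S}^2(W_+)$ is GK $2$-critical. Moreover, for every nonzero $f \in \mathrm{S}^2(W_+)$, the quotient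 $\mathrm{S}^2(W_+)/\mathrm{U}(W_+)f$ has GK-dimension at most $1$. -/

import Mathlib

noncomputable section

/-! ### The positive Witt algebra -/

/-- The positive Witt algebra `W₊` over `k`: the free `k`-module on `e_n`, `n ≥ 1`. -/
def PositiveWitt (k : Type*) [CommRing k] : Type _ := ℕ+ →₀ k

namespace PositiveWitt

variable (k : Type*) [CommRing k]

instance : AddCommGroup (PositiveWitt k) := inferInstanceAs (AddCommGroup (ℕ+ →₀ k))

instance : Module k (PositiveWitt k) := inferInstanceAs (Module k (ℕ+ →₀ k))

/-- The basis `(e_n)_{n ≥ 1}` of `W₊`. -/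
def e : Module.Basis ℕ+ k (PositiveWitt k) := ⟨LinearEquiv.refl k (ℕ+ →₀ k)⟩

/-- The bilinear map with `(e_i, e_j) ↦ (j - i) e_{i+j}`. -/
def bracket : PositiveWitt k →ₗ[k] PositiveWitt k →ₗ[k] PositiveWitt k :=
  (e k).constr k fun i => (e k).constr k fun j =>
    (((j : ℕ) : k) - ((i : ℕ) : k)) • e k (i + j)

theorem bracket_e (i j : ℕ+) :
    bracket k (e k i) (e k j) = (((j : ℕ) : k) - ((i : ℕ) : k)) • e k (i + j) := by
  simp [bracket]

theorem bracket_skew (x y : PositiveWitt k) : bracket k x y = -bracket k y x := by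
  have h : bracket k = -(bracket k).flip := by
    refine (e k).ext fun i => (e k).ext fun j => ?_
    rw [LinearMap.neg_apply, LinearMap.neg_apply, LinearMap.flip_apply, bracket_e, bracket_e,
      add_comm j i, ← neg_smul, neg_sub]
  simpa using LinearMap.congr_fun₂ h x y

@[elab_as_elim]
theorem spanInd {motive : PositiveWitt k → Prop} (x : PositiveWitt k)
    (e : ∀ i, motive (e k i)) (zero : motive 0)
    (add : ∀ x y, motive x → motive y → motive (x + y))
    (smul : ∀ (c : k) x, motive x → motive (c • x)) : motive x := by
  have hx : x ∈ Submodule.span k (Set.range (PositiveWitt.e k)) := by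
    rw [(PositiveWitt.e k).span_eq]; trivial
  induction hx using Submodule.span_induction with
  | mem x h =>
    obtain ⟨i, rfl⟩ := h
    exact e i
  | zero => exact zero
  | add x y _ _ hx hy => exact add x y hx hy
  | smul c x _ hx => exact smul c x hx

theorem bracket_self (x : PositiveWitt k) : bracket k x x = 0 := by
  induction x using spanInd k with
  | e i => simp [bracket_e]
  | zero => simp
  | add x y hx hy => simp [hx, hy, bracket_skew k y x]
  | smul c x hx => simp [hx]

theorem bracket_leibniz (x y z : PositiveWitt k) :
    bracket k x (bracket k y z) =
      bracket k (bracket k x y) z + bracket k y (bracket k x z) := by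
  have h : ∀ z i j, bracket k (e k i) (bracket k (e k j) z) =
      bracket k (bracket k (e k i) (e k j)) z + bracket k (e k j) (bracket k (e k i) z) := by
    intro z i j
    induction z using spanInd k with
    | e l =>
      simp only [bracket_e, map_smul, LinearMap.smul_apply, smul_smul]
      rw [add_left_comm j i l, add_assoc i j l, ← add_smul]
      congr 1
      push_cast
      ring
    | zero => simp
    | add x y hx hy => simp only [map_add, hx, hy]; abel
    | smul c x hx => simp only [map_smul, hx, smul_add]
  induction x using spanInd k with
  | zero => simp
  | add x x' hx hx' => simp only [map_add, LinearMap.add_apply, hx, hx']; abel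
  | smul c x hx => simp only [map_smul, LinearMap.smul_apply, hx, smul_add]
  | e i =>
    induction y using spanInd k with
    | zero => simp
    | add x x' hx hx' => simp only [map_add, LinearMap.add_apply, hx, hx']; abel
    | smul c x hx => simp only [map_smul, LinearMap.smul_apply, hx, smul_add]
    | e j => exact h z i j

instance : LieRing (PositiveWitt k) where
  bracket x y := bracket k x y
  add_lie x y z := by simp
  lie_add x y z := by simp
  lie_self x := bracket_self k x
  leibniz_lie x y z := bracket_leibniz k x y z

instance : LieAlgebra k (PositiveWitt k) where
  lie_smul t x y := (bracket k x).map_smul t y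

theorem lie_e (i j : ℕ+) :
    ⁅e k i, e k j⁆ = (((j : ℕ) : k) - ((i : ℕ) : k)) • e k (i + j) :=
  bracket_e k i j

end PositiveWitt

/-! ### Symmetric powers of a Lie algebra as modules over the enveloping algebra -/

namespace LieSymmetric

variable (k L : Type*) [CommRing k] [LieRing L] [LieAlgebra k L]

attribute [local instance] LieRing.ofAssociativeRing

/-- The algebra map `S(L) → S(L) ⊕ S(L)ε` with `y ↦ y + f(y) ε` for `y ∈ L`. -/
def dualLift (f : L →ₗ[k] L) :
    SymmetricAlgebra k L →ₐ[k]
      TrivSqZeroExt (SymmetricAlgebra k L) (SymmetricAlgebra k L) :=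
  SymmetricAlgebra.lift
    ((TrivSqZeroExt.inlAlgHom k _ _).toLinearMap ∘ₗ SymmetricAlgebra.ι k L +
      (TrivSqZeroExt.inrHom (SymmetricAlgebra k L) (SymmetricAlgebra k L)).restrictScalars k ∘ₗ
        SymmetricAlgebra.ι k L ∘ₗ f)

theorem fst_dualLift (f : L →ₗ[k] L) (a : SymmetricAlgebra k L) :
    (dualLift k L f a).fst = a := by
  have : (TrivSqZeroExt.fstHom k (SymmetricAlgebra k L) (SymmetricAlgebra k L)).comp
      (dualLift k L f) = AlgHom.id k _ := by
    apply SymmetricAlgebra.algHom_ext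
    ext y
    simp [dualLift]
  exact DFunLike.congr_fun this a

/-- The unique derivation of `S(L)` extending the linear map `f : L → L`. -/
def extendDer (f : L →ₗ[k] L) :
    Derivation k (SymmetricAlgebra k L) (SymmetricAlgebra k L) :=
  Derivation.mk'
    ((TrivSqZeroExt.sndHom (SymmetricAlgebra k L) (SymmetricAlgebra k L)).restrictScalars k ∘ₗ
      (dualLift k L f).toLinearMap)
    (fun a b => by simp [fst_dualLift, mul_comm])

theorem extendDer_ι (f : L →ₗ[k] L) (y : L) :
    extendDer k L f (SymmetricAlgebra.ι k L y) = SymmetricAlgebra.ι k L (f y) := by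
  simp [extendDer, dualLift]

theorem derivation_ext {D E : Derivation k (SymmetricAlgebra k L) (SymmetricAlgebra k L)}
    (h : ∀ y, D (SymmetricAlgebra.ι k L y) = E (SymmetricAlgebra.ι k L y)) : D = E := by
  ext a
  induction a using SymmetricAlgebra.induction with
  | algebraMap r => simp
  | ι x => exact h x
  | mul a b ha hb => simp [ha, hb]
  | add a b ha hb => simp [ha, hb]

/-- The action of `L` on `S(L)` by derivations that extends the adjoint action
(equivalently, `x` acts as the Poisson bracket `{x, -}`). -/
def adDer : L →ₗ⁅k⁆ Derivation k (SymmetricAlgebra k L) (SymmetricAlgebra k L) where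
  toFun x := extendDer k L (LieAlgebra.ad k L x)
  map_add' x y := derivation_ext k L fun z => by simp [extendDer_ι]
  map_smul' c x := derivation_ext k L fun z => by simp [extendDer_ι]
  map_lie' {x y} := derivation_ext k L fun z => by
    simp [extendDer_ι, Derivation.commutator_apply]

theorem adDer_ι (x y : L) :
    adDer k L x (SymmetricAlgebra.ι k L y) = SymmetricAlgebra.ι k L ⁅x, y⁆ := by
  simp [adDer, extendDer_ι]

/-- The homogeneous part `Sⁿ(L)` of the symmetric algebra `S(L)`, spanned by the products of `n`
elements of `L`. -/
def symPower (n : ℕ) : Submodule k (SymmetricAlgebra k L) :=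
  LinearMap.range (SymmetricAlgebra.ι k L) ^ n

theorem adDer_mem (n : ℕ) (x : L) {a : SymmetricAlgebra k L} (ha : a ∈ symPower k L n) :
    adDer k L x a ∈ symPower k L n := by
  induction n generalizing a with
  | zero =>
    rw [symPower, pow_zero, Submodule.mem_one] at ha
    obtain ⟨r, rfl⟩ := ha
    simp
  | succ n ih =>
    rw [symPower, pow_succ] at ha ⊢
    refine Submodule.mul_induction_on ha (fun b hb c hc => ?_) (fun b c hb hc => ?_)
    · rw [Derivation.leibniz, smul_eq_mul, smul_eq_mul, mul_comm c]
      refine add_mem (Submodule.mul_mem_mul hb ?_) (Submodule.mul_mem_mul (ih hb) hc)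
      obtain ⟨y, rfl⟩ := hc
      exact ⟨⁅x, y⁆, (adDer_ι k L x y).symm⟩
    · rw [map_add]
      exact add_mem hb hc

/-- `Sⁿ(L)` as a type of its own. -/
def SymPower (n : ℕ) : Type _ := symPower k L n

instance (n : ℕ) : AddCommGroup (SymPower k L n) :=
  inferInstanceAs (AddCommGroup (symPower k L n))

instance (n : ℕ) : Module k (SymPower k L n) :=
  inferInstanceAs (Module k (symPower k L n))

/-- The representation of `L` on `Sⁿ(L)`. -/
def symRep (n : ℕ) : L →ₗ⁅k⁆ Module.End k (SymPower k L n) where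
  toFun x := ((adDer k L x : SymmetricAlgebra k L →ₗ[k] SymmetricAlgebra k L).restrict
    fun _ ha => adDer_mem k L n x ha : symPower k L n →ₗ[k] symPower k L n)
  map_add' x y := LinearMap.ext fun a => Subtype.ext <| by
    change adDer k L (x + y) a.1 = adDer k L x a.1 + adDer k L y a.1
    simp
  map_smul' c x := LinearMap.ext fun a => Subtype.ext <| by
    change adDer k L (c • x) a.1 = c • adDer k L x a.1
    simp
  map_lie' {x y} := LinearMap.ext fun a => Subtype.ext <| by
    change adDer k L ⁅x, y⁆ a.1 =
      adDer k L x (adDer k L y a.1) - adDer k L y (adDer k L x a.1)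
    rw [LieHom.map_lie, Derivation.commutator_apply]

/-- `Sⁿ(L)` as a module over the universal enveloping algebra. -/
instance (n : ℕ) : Module (UniversalEnvelopingAlgebra k L) (SymPower k L n) :=
  Module.compHom (SymPower k L n)
    (UniversalEnvelopingAlgebra.lift k (symRep k L n)).toRingHom

theorem smul_def (n : ℕ) (u : UniversalEnvelopingAlgebra k L) (a : SymPower k L n) :
    u • a = UniversalEnvelopingAlgebra.lift k (symRep k L n) u a := rfl

instance (n : ℕ) :
    IsScalarTower k (UniversalEnvelopingAlgebra k L) (SymPower k L n) where
  smul_assoc c u a := by rw [smul_def, smul_def, map_smul, LinearMap.smul_apply]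

end LieSymmetric

/-! ### Gelfand–Kirillov dimension of modules -/

section GK

variable (k A M : Type*) [Field k] [Ring A] [Algebra k A] [AddCommGroup M] [Module k M]
  [Module A M] [IsScalarTower k A M]

/-- The Gelfand–Kirillov dimension of an `A`-module `M`: the supremum, over all
finite-dimensional subspaces `V ⊆ A` and `F ⊆ M`, of `limsup log_n dim ((k + V)ⁿ F)`, where
`(k + V)ⁿ = ∑_{i ≤ n} Vⁱ`. -/
def GKdim : EReal :=
  ⨆ (V : Submodule k A) (_ : V.FG) (F : Submodule k M) (_ : F.FG),
    Filter.limsup (fun n : ℕ =>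
      ((Real.logb n (Module.finrank k ((1 ⊔ V) ^ n • F : Submodule k M)) : ℝ) : EReal))
      Filter.atTop

/-- `M` is GK `d`-critical: it has GK-dimension `d` and each quotient by a nonzero submodule has
GK-dimension `< d`. -/
def IsGKCritical (d : EReal) : Prop :=
  GKdim k A M = d ∧ ∀ N : Submodule A M, N ≠ ⊥ → GKdim k A (M ⧸ N) < d

end GK

end

/-!
Fix `f ≠ 0` in `S²(W₊)` and write `f = ∑ g_{pq} e_p e_q` with `g` symmetric, ordering the pairs
`(p, q)` by degree and then by `q`. Up to monomials with a factor of bounded index, `e_i e_j f` is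
twice the sum of the `g_{pq} (p - i)(q - j) e_{p+i} e_{q+j}`, so if `j - i` is large its leading
term comes from the leading pair of `f`. Hence, modulo the span of the `e_i e_j f` with `i + j ≤ n`,
every monomial of degree at most `n` reduces to the `O(n)` such monomials near the axes or the
diagonal.

Since `U(W₊)` shifts the filtration by degree boundedly, `S²(W₊)/U(W₊)f` has GK-dimension at most
`1`; since that filtration grows quadratically, `S²(W₊)` has GK-dimension at most `2`. Conversely
`e_i ∈ (k + V)ⁱ` for `V = ⟨e₁, e₂⟩`, so `(k + V)ⁿ f` contains every `e_i e_j f` with `i + j ≤ n`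
and has codimension `O(n)` in a space of quadratic dimension.
-/

section GKBounds

open Filter Topology

theorem tendsto_logb_natCast_add (C : ℝ) (r : ℕ) :
    Tendsto (fun n : ℕ => ((Real.logb n C + r : ℝ) : EReal)) atTop (𝓝 r) := by
  have hlogb : Tendsto (fun n : ℕ => Real.logb n C) atTop (𝓝 0) :=
    tendsto_const_nhds.div_atTop (Real.tendsto_log_atTop.comp tendsto_natCast_atTop_atTop)
  have hadd := hlogb.add_const (r : ℝ)
  rw [zero_add] at hadd
  exact (continuous_coe_real_ereal.tendsto _).comp hadd

theorem logb_mul_self_pow {b C : ℝ} (hb : 1 < b) (hC : C ≠ 0) (r : ℕ) :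
    Real.logb b (C * b ^ r) = Real.logb b C + r := by
  rw [Real.logb_mul hC (by positivity), Real.logb_pow, Real.logb_self_eq_one hb, mul_one]

theorem limsup_logb_le {u : ℕ → ℕ} {C r : ℕ} (h : ∀ᶠ n in atTop, u n ≤ C * n ^ r) :
    limsup (fun n : ℕ => ((Real.logb n (u n) : ℝ) : EReal)) atTop ≤ r := by
  rw [← (tendsto_logb_natCast_add C r).limsup_eq]
  refine limsup_le_limsup ?_
  filter_upwards [h, eventually_ge_atTop 2] with n hu hn
  have hn1 : (1 : ℝ) < n := by exact_mod_cast hn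
  rw [EReal.coe_le_coe_iff]
  rcases Nat.eq_zero_or_pos (u n) with hu0 | hu0
  · rw [hu0, Nat.cast_zero, Real.logb_zero]
    exact add_nonneg (div_nonneg (Real.log_natCast_nonneg C) (Real.log_natCast_nonneg n))
      r.cast_nonneg
  · have hC : C ≠ 0 := by
      rintro rfl
      omega
    rw [← logb_mul_self_pow hn1 (Nat.cast_ne_zero.2 hC)]
    exact Real.logb_le_logb_of_le hn1 (by exact_mod_cast hu0) (by exact_mod_cast hu)

theorem le_limsup_logb {u : ℕ → ℕ} {C r : ℕ} (h : ∀ᶠ n in atTop, n ^ r ≤ C * u n) :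
    r ≤ limsup (fun n : ℕ => ((Real.logb n (u n) : ℝ) : EReal)) atTop := by
  rw [← (tendsto_logb_natCast_add (C : ℝ)⁻¹ r).limsup_eq]
  refine limsup_le_limsup ?_
  filter_upwards [h, eventually_ge_atTop 2] with n hu hn
  have hn1 : (1 : ℝ) < n := by exact_mod_cast hn
  have hC : 0 < C := Nat.pos_of_mul_pos_right ((pow_pos (by omega) r).trans_le hu)
  rw [EReal.coe_le_coe_iff, ← logb_mul_self_pow hn1 (by positivity)]
  refine Real.logb_le_logb_of_le hn1 (by positivity) ?_
  rw [inv_mul_le_iff₀ (by positivity)]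
  exact_mod_cast hu

variable {k A M : Type*} [Field k] [Ring A] [Algebra k A] [AddCommGroup M] [Module k M]
  [Module A M] [IsScalarTower k A M]

theorem fg_smul {V : Submodule k A} {F : Submodule k M} (hV : V.FG) (hF : F.FG) :
    (V • F).FG := by
  let act : A →ₗ[k] M →ₗ[k] M := (Algebra.lsmul k k M).toLinearMap
  have : Module.Finite k (Submodule.map₂ act V F) := Module.Finite.iff_fg.2 (hV.map₂ _ hF)
  have hle : V • F ≤ Submodule.map₂ act V F :=
    Submodule.smul_le.2 fun v hv x hx => Submodule.apply_mem_map₂ act hv hx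
  exact Module.Finite.iff_fg.1 (Submodule.finiteDimensional_of_le hle)

/-- The elements of `A` acting with bounded degree on a filtered module: those `u` for which some
`d` satisfies `u • Fil n ⊆ Fil (n + d)` for all `n`. -/
def boundedDegree (A : Type*) [Ring A] [Algebra k A] [Module A M] [IsScalarTower k A M]
    (Fil : ℕ →o Submodule k M) : Subalgebra k A where
  carrier := {u | ∃ d, ∀ n, ∀ x ∈ Fil n, u • x ∈ Fil (n + d)}
  mul_mem' := by
    rintro u v ⟨d, hu⟩ ⟨d', hv⟩
    refine ⟨d' + d, fun n x hx => ?_⟩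
    rw [mul_smul, ← add_assoc]
    exact hu _ _ (hv n x hx)
  add_mem' := by
    rintro u v ⟨d, hu⟩ ⟨d', hv⟩
    refine ⟨max d d', fun n x hx => ?_⟩
    rw [add_smul]
    exact add_mem (Fil.monotone (by omega) (hu n x hx)) (Fil.monotone (by omega) (hv n x hx))
  algebraMap_mem' c := by
    refine ⟨0, fun n x hx => ?_⟩
    rw [algebraMap_smul]
    exact Submodule.smul_mem _ c hx

variable {Fil : ℕ →o Submodule k M} {V : Submodule k A} {F : Submodule k M}

theorem exists_smul_le_of_le_boundedDegree (hV : V.FG)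
    (hVF : V ≤ Subalgebra.toSubmodule (boundedDegree A Fil)) :
    ∃ d, ∀ n, V • Fil n ≤ Fil (n + d) := by
  induction V, hV using Submodule.fg_induction with
  | singleton u =>
    obtain ⟨d, hd⟩ := hVF (Submodule.mem_span_singleton_self u)
    refine ⟨d, fun n => Submodule.smul_le.2 fun v hv x hx => ?_⟩
    obtain ⟨c, rfl⟩ := Submodule.mem_span_singleton.1 hv
    rw [smul_assoc]
    exact Submodule.smul_mem _ _ (hd n x hx)
  | sup V₁ V₂ _ _ ih₁ ih₂ =>
    obtain ⟨d₁, h₁⟩ := ih₁ (le_sup_left.trans hVF)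
    obtain ⟨d₂, h₂⟩ := ih₂ (le_sup_right.trans hVF)
    refine ⟨max d₁ d₂, fun n => ?_⟩
    rw [Submodule.sup_smul]
    exact sup_le ((h₁ n).trans (Fil.monotone (by omega)))
      ((h₂ n).trans (Fil.monotone (by omega)))

theorem exists_le_of_le_iSup (hF : F.FG) (hFil : F ≤ ⨆ n, Fil n) : ∃ n, F ≤ Fil n := by
  induction F, hF using Submodule.fg_induction with
  | singleton x =>
    simpa only [Submodule.span_singleton_le_iff_mem, Submodule.mem_iSup_of_chain] using hFil
  | sup F₁ F₂ _ _ ih₁ ih₂ =>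
    obtain ⟨n₁, h₁⟩ := ih₁ (le_sup_left.trans hFil)
    obtain ⟨n₂, h₂⟩ := ih₂ (le_sup_right.trans hFil)
    exact ⟨max n₁ n₂, sup_le (h₁.trans (Fil.monotone (le_max_left _ _)))
      (h₂.trans (Fil.monotone (le_max_right _ _)))⟩

theorem one_sup_pow_smul_le {d : ℕ} (hV : ∀ n, V • Fil n ≤ Fil (n + d)) (m n : ℕ) :
    (1 ⊔ V) ^ m • Fil n ≤ Fil (n + m * d) := by
  induction m generalizing n with
  | zero => rw [pow_zero, Submodule.one_smul, zero_mul, add_zero]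
  | succ m ih =>
    have hone : (1 ⊔ V) • Fil n ≤ Fil (n + d) := by
      rw [Submodule.sup_smul, Submodule.one_smul]
      exact sup_le (Fil.monotone (by omega)) (hV n)
    calc (1 ⊔ V) ^ (m + 1) • Fil n = (1 ⊔ V) ^ m • (1 ⊔ V) • Fil n := by
          rw [pow_succ, ← smul_eq_mul, Submodule.smul_assoc]
      _ ≤ (1 ⊔ V) ^ m • Fil (n + d) := Submodule.smul_mono le_rfl hone
      _ ≤ Fil (n + d + m * d) := ih (n + d)
      _ = Fil (n + (m + 1) * d) := by congr 1; ring

theorem GKdim_le_of_filtration [∀ n, Module.Finite k (Fil n)] (hbdd : boundedDegree A Fil = ⊤)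
    (hFil : ⨆ n, Fil n = ⊤) {C r : ℕ}
    (hgrowth : ∀ n, Module.finrank k (Fil n) ≤ C * (n + 1) ^ r) :
    GKdim k A M ≤ r := by
  refine iSup₂_le fun V hV => iSup₂_le fun F hF => ?_
  obtain ⟨d, hd⟩ := exists_smul_le_of_le_boundedDegree (Fil := Fil) hV (by simp [hbdd])
  obtain ⟨D, hD⟩ := exists_le_of_le_iSup hF (hFil ▸ le_top)
  refine limsup_logb_le (C := C * (D + d + 1) ^ r) ?_
  filter_upwards [eventually_ge_atTop 1] with n hn
  calc Module.finrank k ((1 ⊔ V) ^ n • F : Submodule k M)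
      ≤ Module.finrank k (Fil (D + n * d)) :=
        Submodule.finrank_mono ((Submodule.smul_mono le_rfl hD).trans (one_sup_pow_smul_le hd n D))
    _ ≤ C * (D + n * d + 1) ^ r := hgrowth _
    _ ≤ C * ((D + d + 1) * n) ^ r := by gcongr; nlinarith
    _ = C * (D + d + 1) ^ r * n ^ r := by rw [mul_pow, mul_assoc]

theorem GKdim_quotient_le_of_filtration (hbdd : boundedDegree A Fil = ⊤) (hFil : ⨆ n, Fil n = ⊤)
    (N : Submodule A M) (B : ℕ → Submodule k M) [∀ n, Module.Finite k (B n)]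
    (hle : ∀ n, Fil n ≤ N.restrictScalars k ⊔ B n) {C r : ℕ}
    (hgrowth : ∀ n, Module.finrank k (B n) ≤ C * (n + 1) ^ r) :
    GKdim k A (M ⧸ N) ≤ r := by
  let π : M →ₗ[k] M ⧸ N := N.mkQ.restrictScalars k
  let FilQ : ℕ →o Submodule k (M ⧸ N) :=
    ⟨fun n => (Fil n).map π, fun m n h => Submodule.map_mono (Fil.monotone h)⟩
  have hN : (N.restrictScalars k).map π = ⊥ := by
    refine eq_bot_iff.2 ?_
    rintro _ ⟨x, hx, rfl⟩
    exact (Submodule.Quotient.mk_eq_zero N).2 hx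
  have hleQ (n : ℕ) : FilQ n ≤ (B n).map π := by
    have hmap := Submodule.map_mono (f := π) (hle n)
    rwa [Submodule.map_sup, hN, bot_sup_eq] at hmap
  have hfin (n : ℕ) : Module.Finite k (FilQ n) := Submodule.finiteDimensional_of_le (hleQ n)
  have hbddQ : boundedDegree A FilQ = ⊤ := by
    refine eq_top_iff.2 fun u _ => ?_
    obtain ⟨d, hd⟩ := (hbdd ▸ Algebra.mem_top : u ∈ boundedDegree A Fil)
    refine ⟨d, ?_⟩
    rintro n _ ⟨x, hx, rfl⟩
    exact ⟨u • x, hd n x hx, rfl⟩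
  have hFilQ : ⨆ n, FilQ n = ⊤ := by
    change ⨆ n, (Fil n).map π = ⊤
    rw [← Submodule.map_iSup, hFil, Submodule.map_top]
    exact LinearMap.range_eq_top.2 N.mkQ_surjective
  exact GKdim_le_of_filtration hbddQ hFilQ fun n =>
    (Submodule.finrank_mono (hleQ n)).trans ((Submodule.finrank_map_le π _).trans (hgrowth n))

theorem le_GKdim (hV : V.FG) (hF : F.FG) {C r : ℕ}
    (h : ∀ᶠ n : ℕ in atTop,
      n ^ r ≤ C * Module.finrank k ((1 ⊔ V) ^ n • F : Submodule k M)) :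
    r ≤ GKdim k A M :=
  (le_limsup_logb h).trans (le_iSup₂_of_le V hV (le_iSup₂_of_le F hF le_rfl))

end GKBounds

namespace LieSymmetric

variable {k L I : Type*} [CommRing k] [LieRing L] [LieAlgebra k L]

theorem adjoin_range_ι :
    Algebra.adjoin k (Set.range (UniversalEnvelopingAlgebra.ι k (L := L))) = ⊤ := by
  have hrange : Set.range (UniversalEnvelopingAlgebra.ι k (L := L)) =
      UniversalEnvelopingAlgebra.mkAlgHom k L '' Set.range (TensorAlgebra.ι k) := by
    rw [← Set.range_comp]
    rfl
  have hsurj : Function.Surjective (UniversalEnvelopingAlgebra.mkAlgHom k L) :=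
    Quotient.mk_surjective
  rw [hrange, ← AlgHom.map_adjoin, TensorAlgebra.adjoin_range_ι, Algebra.map_top,
    AlgHom.range_eq_top]
  exact hsurj

theorem ι_mul_ι_mem_symPower_two (x y : L) :
    SymmetricAlgebra.ι k L x * SymmetricAlgebra.ι k L y ∈ symPower k L 2 := by
  rw [symPower, pow_two]
  exact Submodule.mul_mem_mul (LinearMap.mem_range_self _ x) (LinearMap.mem_range_self _ y)

/-- The product `L × L → S²(L)` of the symmetric algebra, as a bilinear map. -/
noncomputable def symProd : L →ₗ[k] L →ₗ[k] SymPower k L 2 :=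
  LinearMap.mk₂ k
    (fun x y => (⟨_, ι_mul_ι_mem_symPower_two x y⟩ : symPower k L 2))
    (fun _ _ _ => Subtype.ext ((congrArg (· * _) (map_add _ _ _)).trans (add_mul _ _ _)))
    (fun _ _ _ => Subtype.ext ((congrArg (· * _) (map_smul _ _ _)).trans (smul_mul_assoc _ _ _)))
    (fun _ _ _ => Subtype.ext ((congrArg (_ * ·) (map_add _ _ _)).trans (mul_add _ _ _)))
    (fun _ _ _ => Subtype.ext ((congrArg (_ * ·) (map_smul _ _ _)).trans (mul_smul_comm _ _ _)))

theorem symProd_comm (x y : L) : symProd (k := k) x y = symProd y x :=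
  Subtype.ext (mul_comm _ _)

theorem ι_smul_symProd (x y z : L) :
    UniversalEnvelopingAlgebra.ι k x • symProd (k := k) y z =
      symProd ⁅x, y⁆ z + symProd y ⁅x, z⁆ := by
  rw [smul_def, UniversalEnvelopingAlgebra.lift_ι_apply]
  refine Subtype.ext ?_
  change adDer k L x (SymmetricAlgebra.ι k L y * SymmetricAlgebra.ι k L z) =
    SymmetricAlgebra.ι k L ⁅x, y⁆ * SymmetricAlgebra.ι k L z +
      SymmetricAlgebra.ι k L y * SymmetricAlgebra.ι k L ⁅x, z⁆
  rw [Derivation.leibniz, adDer_ι, adDer_ι, smul_eq_mul, smul_eq_mul]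
  ring

/-- The quadratic monomials `bᵢ bⱼ` in a family `b` of elements of `L`, indexed by unordered
pairs. -/
noncomputable def quadMonomial (b : I → L) : Sym2 I → SymPower k L 2 :=
  Sym2.lift ⟨fun i j => symProd (b i) (b j), fun _ _ => symProd_comm _ _⟩

open Pointwise in
theorem span_range_quadMonomial (b : Module.Basis I k L) :
    Submodule.span k (Set.range (quadMonomial (k := k) b)) = ⊤ := by
  let incl : SymPower k L 2 →ₗ[k] SymmetricAlgebra k L := (symPower k L 2).subtype
  have hgen : LinearMap.range (SymmetricAlgebra.ι k L) =
      Submodule.span k (Set.range (SymmetricAlgebra.ι k L ∘ b)) := by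
    rw [Set.range_comp, ← Submodule.map_span, b.span_eq, Submodule.map_top]
  have himage : incl '' Set.range (quadMonomial (k := k) b) =
      Set.range (SymmetricAlgebra.ι k L ∘ b) * Set.range (SymmetricAlgebra.ι k L ∘ b) := by
    rw [← Set.image2_mul, Set.image2_range, ← Set.range_comp]
    ext a
    constructor
    · rintro ⟨⟨i, j⟩, rfl⟩
      exact ⟨(i, j), rfl⟩
    · rintro ⟨⟨i, j⟩, rfl⟩
      exact ⟨s(i, j), rfl⟩
  refine Submodule.map_injective_of_injective (f := incl) Subtype.val_injective ?_
  rw [Submodule.map_span, himage, ← Submodule.span_mul_span, ← hgen, Submodule.map_top]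
  change _ = LinearMap.range (symPower k L 2).subtype
  rw [Submodule.range_subtype, symPower, pow_two]

theorem injective_single_add_single : Function.Injective
    (Sym2.lift ⟨fun i j : I => (Finsupp.single i 1 + Finsupp.single j 1 : I →₀ ℕ),
      fun _ _ => add_comm _ _⟩) := by
  classical
  rintro ⟨i, j⟩ ⟨i', j'⟩ h
  have hpair : ({i, j} : Multiset I) = {i', j'} := by
    have htoMultiset := congrArg Finsupp.toMultiset h
    simpa [Sym2.lift] using htoMultiset
  exact (Sym2.equivMultiset I).injective (Subtype.ext hpair)

theorem linearIndependent_quadMonomial (b : Module.Basis I k L) :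
    LinearIndependent k (quadMonomial (k := k) b) := by
  let toMvPolynomial : SymPower k L 2 →ₗ[k] MvPolynomial I k :=
    (SymmetricAlgebra.equivMvPolynomial b).toLinearMap ∘ₗ (symPower k L 2).subtype
  refine LinearIndependent.of_comp toMvPolynomial ?_
  have hcomp : toMvPolynomial ∘ quadMonomial b = MvPolynomial.basisMonomials I k ∘
      Sym2.lift ⟨fun i j => Finsupp.single i 1 + Finsupp.single j 1, fun _ _ => add_comm _ _⟩ := by
    ext1 ⟨i, j⟩
    change SymmetricAlgebra.equivMvPolynomial b
      (SymmetricAlgebra.ι k L (b i) * SymmetricAlgebra.ι k L (b j)) =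
        MvPolynomial.basisMonomials I k (Finsupp.single i 1 + Finsupp.single j 1)
    rw [map_mul, SymmetricAlgebra.equivMvPolynomial_ι_apply,
      SymmetricAlgebra.equivMvPolynomial_ι_apply, MvPolynomial.X, MvPolynomial.X,
      MvPolynomial.monomial_mul, one_mul, MvPolynomial.coe_basisMonomials]
  rw [hcomp]
  exact (MvPolynomial.basisMonomials I k).linearIndependent.comp _ injective_single_add_single

end LieSymmetric

namespace PositiveWitt

open LieSymmetric

section Monomials

variable (k : Type*) [CommRing k]

/-- The enveloping algebra `U(W₊)`. -/
abbrev Enveloping : Type _ := UniversalEnvelopingAlgebra k (PositiveWitt k)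

/-- The module `S²(W₊)`. -/
abbrev SymSq : Type _ := SymPower k (PositiveWitt k) 2

/-- The monomial `e_p e_q` in `S²(W₊)`, with the pair `(p, q)` ordered for convenience. -/
noncomputable def mono (p : ℕ+ × ℕ+) : SymSq k := symProd (e k p.1) (e k p.2)

/-- The basis element `e_n` of `W₊` as an element of `U(W₊)`. -/
noncomputable def eU (n : ℕ+) : Enveloping k := UniversalEnvelopingAlgebra.ι k (e k n)

theorem mono_swap (p : ℕ+ × ℕ+) : mono k p.swap = mono k p := symProd_comm _ _

theorem eU_smul_mono (n : ℕ+) (p : ℕ+ × ℕ+) :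
    eU k n • mono k p = ((p.1 : ℕ) - (n : ℕ) : k) • mono k (p.1 + n, p.2) +
      ((p.2 : ℕ) - (n : ℕ) : k) • mono k (p.1, p.2 + n) := by
  simp only [eU, mono, ι_smul_symProd, lie_e, map_smul, LinearMap.smul_apply, add_comm n]

theorem span_range_mono : Submodule.span k (Set.range (mono k)) = ⊤ := by
  rw [← span_range_quadMonomial (e k)]
  refine congrArg _ (Set.ext fun x => ⟨?_, ?_⟩)
  · rintro ⟨p, rfl⟩
    exact ⟨s(p.1, p.2), rfl⟩
  · rintro ⟨⟨p⟩, rfl⟩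
    exact ⟨p, rfl⟩

theorem quadMonomial_e (p : ℕ+ × ℕ+) : quadMonomial (e k) s(p.1, p.2) = mono k p := rfl

theorem linearIndependent_mono_comp {ι : Type*} {x : ι → ℕ+ × ℕ+}
    (hx : Function.Injective fun i => s((x i).1, (x i).2)) :
    LinearIndependent k fun i => mono k (x i) := by
  have hli := (linearIndependent_quadMonomial (e k)).comp _ hx
  simpa only [Function.comp_def, quadMonomial_e] using hli

/-- Half of the action of `e_i e_j ∈ U(W₊)` on `e_p e_q`: the terms in which `e_i` hits the first
factor. The other half is obtained by exchanging `p` and `q`. -/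
noncomputable def halfAction (i j : ℕ+) (p : ℕ+ × ℕ+) : SymSq k :=
  (((p.1 : ℕ) - (i : ℕ) : k) * ((p.2 : ℕ) - (j : ℕ))) • mono k (p + (i, j)) +
    (((p.1 : ℕ) - (j : ℕ) : k) * ((p.1 : ℕ) + (j : ℕ) - (i : ℕ))) • mono k (p.1 + j + i, p.2)

theorem eU_smul_eU_smul_mono (i j : ℕ+) (p : ℕ+ × ℕ+) :
    eU k i • eU k j • mono k p = halfAction k i j p + halfAction k i j p.swap := by
  obtain ⟨p, q⟩ := p
  simp only [eU_smul_mono, smul_add, smul_comm (eU k i) (_ : k), smul_smul, halfAction,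
    Prod.swap_prod_mk, Prod.mk_add_mk, PNat.add_coe, Nat.cast_add, ← mono_swap k (q + i, p + j),
    ← mono_swap k (q + j + i, p)]
  module

theorem eU_smul_eU_smul_linearCombination (i j : ℕ+) {g : ℕ+ × ℕ+ →₀ k}
    (hg : g.mapDomain Prod.swap = g) :
    eU k i • eU k j • Finsupp.linearCombination k (mono k) g =
      (2 : k) • Finsupp.linearCombination k (halfAction k i j) g := by
  have hswap : Finsupp.linearCombination k (halfAction k i j ∘ Prod.swap) g =
      Finsupp.linearCombination k (halfAction k i j) g := by
    rw [← Finsupp.linearCombination_mapDomain, hg]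
  calc eU k i • eU k j • Finsupp.linearCombination k (mono k) g
      = Algebra.lsmul k k (SymSq k) (eU k i * eU k j)
          (Finsupp.linearCombination k (mono k) g) := (mul_smul _ _ _).symm
    _ = Finsupp.linearCombination k (halfAction k i j) g +
          Finsupp.linearCombination k (halfAction k i j ∘ Prod.swap) g := by
        rw [Finsupp.apply_linearCombination]
        simp only [Finsupp.linearCombination_apply, Finsupp.sum, ← Finset.sum_add_distrib,
          ← smul_add]
        refine Finset.sum_congr rfl fun p _ => congrArg _ ?_
        exact (mul_smul _ _ _).trans (eU_smul_eU_smul_mono k i j p)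
    _ = (2 : k) • Finsupp.linearCombination k (halfAction k i j) g := by rw [hswap, two_smul]

end Monomials

theorem exists_symmetric_linearCombination_mono (k : Type*) [Field k] [NeZero (2 : k)]
    (f : SymSq k) :
    ∃ g : ℕ+ × ℕ+ →₀ k, g.mapDomain Prod.swap = g ∧ Finsupp.linearCombination k (mono k) g = f := by
  have hf : f ∈ Submodule.span k (Set.range (mono k)) := span_range_mono k ▸ Submodule.mem_top
  obtain ⟨g, rfl⟩ := Finsupp.mem_span_range_iff_exists_finsupp.1 hf
  refine ⟨(2⁻¹ : k) • (g + g.mapDomain Prod.swap), ?_, ?_⟩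
  · rw [Finsupp.mapDomain_smul, Finsupp.mapDomain_add, ← Finsupp.mapDomain_comp,
      Prod.swap_swap_eq, Finsupp.mapDomain_id, add_comm]
  · have hswap : mono k ∘ Prod.swap = mono k := funext (mono_swap k)
    rw [map_smul, map_add, Finsupp.linearCombination_mapDomain, hswap, ← two_smul k, smul_smul,
      inv_mul_cancel₀ two_ne_zero, one_smul, Finsupp.linearCombination_apply]

section LeadingExponent

/-- The order on exponents used to select leading terms: by total degree, then by the second
exponent. -/
def weight (p : ℕ+ × ℕ+) : ℕ ×ₗ ℕ := toLex (p.1 + p.2, p.2)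

theorem weight_lt_weight {p q : ℕ+ × ℕ+} :
    weight p < weight q ↔
      (p.1 + p.2 : ℕ) < q.1 + q.2 ∨ (p.1 + p.2 : ℕ) = q.1 + q.2 ∧ (p.2 : ℕ) < q.2 :=
  Prod.Lex.toLex_lt_toLex

theorem weight_injective : Function.Injective weight := by
  intro p q h
  obtain ⟨hsum, hsnd⟩ := Prod.ext_iff.1 (toLex.injective h)
  dsimp only at hsum hsnd
  exact Prod.ext (PNat.eq (by omega)) (PNat.eq hsnd)

theorem exists_weight_lt_of_ne {S : Finset (ℕ+ × ℕ+)} (hS : S.Nonempty) :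
    ∃ p ∈ S, ∀ q ∈ S, q ≠ p → weight q < weight p := by
  obtain ⟨p, hp, hmax⟩ := S.exists_max_image weight hS
  exact ⟨p, hp, fun q hq hqp => (hmax q hq).lt_of_ne (weight_injective.ne hqp)⟩

theorem weight_add_lt_of_weight_lt {p p₀ r : ℕ+ × ℕ+} (h : weight p < weight p₀)
    (hr : p₀.1 + r.1 ≤ r.2) :
    weight (p + r) < weight (p₀ + r) ∧ weight (p + r).swap < weight (p₀ + r) := by
  have hp := p.2.pos
  simp only [weight_lt_weight, Prod.fst_swap, Prod.snd_swap, Prod.fst_add, Prod.snd_add,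
    PNat.add_coe, ← PNat.coe_le_coe] at *
  omega

end LeadingExponent

section Reduction

variable (k : Type*) [CommRing k]

/-- The subspace of `S²(W₊)` spanned by the monomials with exponents in `S`. -/
noncomputable def monoSpan (S : Set (ℕ+ × ℕ+)) : Submodule k (SymSq k) :=
  Submodule.span k (mono k '' S)

variable {k}

/-- The span of the elements `e_i e_j f` with `i + j ≤ n`. -/
noncomputable def quadSpan (f : SymSq k) (n : ℕ) : Submodule k (SymSq k) :=
  Submodule.span k {x | ∃ i j : ℕ+, (i + j : ℕ) ≤ n ∧ eU k i • eU k j • f = x}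

/-- The exponents `(p, q)` of degree at most `n` with `p` small or `q` at or slightly above `p`: up
to exchanging `p` and `q`, the neighbourhoods of width `K` of the axes and of the diagonal. -/
def boundary (K n : ℕ) : Set (ℕ+ × ℕ+) :=
  {p | (p.1 + p.2 : ℕ) ≤ n ∧ ((p.1 : ℕ) < K ∨ p.1 ≤ p.2 ∧ (p.2 : ℕ) < p.1 + K)}

theorem mono_mem_monoSpan {S : Set (ℕ+ × ℕ+)} {p : ℕ+ × ℕ+} (hp : p ∈ S) :
    mono k p ∈ monoSpan k S :=
  Submodule.subset_span (Set.mem_image_of_mem _ hp)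

theorem exists_add_eq_of_notMem_boundary {p₀ a : ℕ+ × ℕ+} {n : ℕ} (ha : a.1 ≤ a.2)
    (han : (a.1 + a.2 : ℕ) ≤ n) (hab : a ∉ boundary (2 * (p₀.1 + p₀.2)) n) :
    ∃ i j : ℕ+, p₀ + (i, j) = a ∧ p₀.1 < i ∧ p₀.2 < j ∧ p₀.1 + i ≤ j := by
  have hp₁ := p₀.1.pos
  have hp₂ := p₀.2.pos
  obtain ⟨ha₁, ha₂⟩ : 2 * (p₀.1 + p₀.2 : ℕ) ≤ a.1 ∧ a.1 + 2 * (p₀.1 + p₀.2 : ℕ) ≤ a.2 := by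
    simp only [boundary, Set.mem_ofPred_eq] at hab
    grind
  have hadd₁ := PNat.add_sub_of_lt (a := p₀.1) (b := a.1) (by rw [← PNat.coe_lt_coe]; omega)
  have hadd₂ := PNat.add_sub_of_lt (a := p₀.2) (b := a.2) (by rw [← PNat.coe_lt_coe]; omega)
  refine ⟨a.1 - p₀.1, a.2 - p₀.2, Prod.ext hadd₁ hadd₂, ?_⟩
  have hadd₁ := congrArg PNat.val hadd₁
  have hadd₂ := congrArg PNat.val hadd₂
  simp only [PNat.add_coe, ← PNat.coe_lt_coe, ← PNat.coe_le_coe] at *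
  omega

end Reduction

section CharZero

variable {k : Type*} [Field k] [CharZero k]

theorem mono_add_mem_of_leading {T : Submodule k (SymSq k)} {g : ℕ+ × ℕ+ →₀ k}
    (hg : g.mapDomain Prod.swap = g) {p₀ : ℕ+ × ℕ+} (hp₀ : p₀ ∈ g.support) {i j : ℕ+}
    (hi : p₀.1 ≠ i) (hj : p₀.2 ≠ j)
    (hact : eU k i • eU k j • Finsupp.linearCombination k (mono k) g ∈ T)
    (hedge : ∀ p ∈ g.support, mono k (p.1 + j + i, p.2) ∈ T)
    (hlower : ∀ p ∈ g.support, p ≠ p₀ → mono k (p + (i, j)) ∈ T) :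
    mono k (p₀ + (i, j)) ∈ T := by
  rw [eU_smul_eU_smul_linearCombination k i j hg, Submodule.smul_mem_iff T two_ne_zero,
    Finsupp.linearCombination_apply, Finsupp.sum, ← Finset.add_sum_erase _ _ hp₀] at hact
  have hrest : ∑ p ∈ g.support.erase p₀, g p • halfAction k i j p ∈ T := by
    refine T.sum_mem fun p hp => T.smul_mem _ ?_
    obtain ⟨hne, hp⟩ := Finset.mem_erase.1 hp
    exact T.add_mem (T.smul_mem _ (hlower p hp hne)) (T.smul_mem _ (hedge p hp))
  have hlead := (T.add_mem_iff_left hrest).1 hact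
  rw [Submodule.smul_mem_iff T (Finsupp.mem_support_iff.1 hp₀), halfAction,
    T.add_mem_iff_left (T.smul_mem _ (hedge p₀ hp₀))] at hlead
  refine (Submodule.smul_mem_iff T (mul_ne_zero ?_ ?_)).1 hlead
  · exact sub_ne_zero.2 fun h => hi (PNat.eq (Nat.cast_injective h))
  · exact sub_ne_zero.2 fun h => hj (PNat.eq (Nat.cast_injective h))

theorem mono_mem_quadSpan_sup_boundary {g : ℕ+ × ℕ+ →₀ k} (hg : g.mapDomain Prod.swap = g)
    {p₀ : ℕ+ × ℕ+} (hp₀ : p₀ ∈ g.support)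
    (hlead : ∀ p ∈ g.support, p ≠ p₀ → weight p < weight p₀) {n : ℕ} {a : ℕ+ × ℕ+}
    (ha : a.1 ≤ a.2) (han : (a.1 + a.2 : ℕ) ≤ n) :
    mono k a ∈ quadSpan (Finsupp.linearCombination k (mono k) g) n ⊔
      monoSpan k (boundary (2 * (p₀.1 + p₀.2)) n) := by
  induction hw : weight a using WellFoundedLT.induction generalizing a with
  | ind w ih =>
  subst hw
  by_cases hab : a ∈ boundary (2 * (p₀.1 + p₀.2)) n
  · exact Submodule.mem_sup_right (mono_mem_monoSpan hab)
  obtain ⟨i, j, rfl, hi, hj, hij⟩ := exists_add_eq_of_notMem_boundary ha han hab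
  have hsum : (p₀.1 + p₀.2 + i + j : ℕ) ≤ n := by
    simp only [Prod.fst_add, Prod.snd_add, PNat.add_coe] at han
    omega
  refine mono_add_mem_of_leading hg hp₀ hi.ne hj.ne ?_ (fun p hp => ?_) fun p hp hpp₀ => ?_
  · exact Submodule.mem_sup_left (Submodule.subset_span ⟨i, j, by omega, rfl⟩)
  · have hdeg : (p.1 + p.2 : ℕ) ≤ p₀.1 + p₀.2 := by
      by_cases hpp₀ : p = p₀
      · rw [hpp₀]
      · have := weight_lt_weight.1 (hlead p hp hpp₀)
        omega
    rw [← mono_swap]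
    refine Submodule.mem_sup_right (mono_mem_monoSpan ⟨?_, Or.inl ?_⟩) <;>
      simp only [Prod.swap_prod_mk, PNat.add_coe]
    · omega
    · have := p.1.pos
      omega
  · have hlt := weight_lt_weight.1 (hlead p hp hpp₀)
    obtain ⟨hw, hwswap⟩ := weight_add_lt_of_weight_lt (r := (i, j)) (hlead p hp hpp₀) hij
    have hdeg : ((p.1 + i : ℕ+) + (p.2 + j : ℕ+) : ℕ) ≤ n := by
      simp only [PNat.add_coe]
      omega
    rcases le_total (p.1 + i) (p.2 + j) with hle | hle
    · exact ih _ hw hle hdeg rfl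
    · rw [← mono_swap]
      exact ih _ hwswap hle ((add_comm _ _).trans_le hdeg) rfl

end CharZero

variable (k : Type*) [Field k]

theorem finite_monoSpan {S : Set (ℕ+ × ℕ+)} (hS : S.Finite) : Module.Finite k (monoSpan k S) :=
  FiniteDimensional.span_of_finite k (hS.image _)

theorem finrank_monoSpan_le {S : Set (ℕ+ × ℕ+)} (hS : S.Finite) :
    Module.finrank k (monoSpan k S) ≤ S.ncard := by
  have := (hS.image (mono k)).fintype
  calc Module.finrank k (monoSpan k S) ≤ (mono k '' S).toFinset.card := finrank_span_le_card _
    _ = (mono k '' S).ncard := (Set.ncard_eq_toFinset_card' _).symm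
    _ ≤ S.ncard := Set.ncard_image_le hS

/-- The exponents of degree at most `n`. -/
def simplex (n : ℕ) : Set (ℕ+ × ℕ+) := {p | (p.1 + p.2 : ℕ) ≤ n}

theorem mapsTo_simplex (n : ℕ) : Set.MapsTo (fun p : ℕ+ × ℕ+ => ((p.1 : ℕ), (p.2 : ℕ)))
    (simplex n) (Finset.range (n + 1) ×ˢ Finset.range (n + 1) : Finset (ℕ × ℕ)) := by
  intro p hp
  have hp : (p.1 + p.2 : ℕ) ≤ n := hp
  simp only [Finset.coe_product, Finset.coe_range, Set.mem_prod, Set.mem_Iio]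
  omega

theorem injective_coe_prod :
    Function.Injective fun p : ℕ+ × ℕ+ => ((p.1 : ℕ), (p.2 : ℕ)) :=
  PNat.coe_injective.prodMap PNat.coe_injective

theorem finite_simplex (n : ℕ) : (simplex n).Finite :=
  Set.Finite.of_injOn (mapsTo_simplex n) injective_coe_prod.injOn (Finset.finite_toSet _)

theorem ncard_simplex_le (n : ℕ) : (simplex n).ncard ≤ (n + 1) ^ 2 := by
  have h := Set.ncard_le_ncard_of_injOn _ (mapsTo_simplex n) injective_coe_prod.injOn
  rwa [Set.ncard_coe_finset, Finset.card_product, Finset.card_range, ← pow_two] at h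

theorem finite_boundary (K n : ℕ) : (boundary K n).Finite :=
  (finite_simplex n).subset fun _ hp => hp.1

theorem ncard_boundary_le (K n : ℕ) : (boundary K n).ncard ≤ 2 * K * (n + 1) := by
  let strip : Set (ℕ × ℕ) := (Finset.range K ×ˢ Finset.range (n + 1) : Finset (ℕ × ℕ))
  have hstrip : strip.ncard = K * (n + 1) := by
    simp only [strip, Set.ncard_coe_finset, Finset.card_product, Finset.card_range]
  let axis : Set (ℕ+ × ℕ+) := {p | (p.1 + p.2 : ℕ) ≤ n ∧ (p.1 : ℕ) < K}
  let diag : Set (ℕ+ × ℕ+) := {p | (p.1 + p.2 : ℕ) ≤ n ∧ p.1 ≤ p.2 ∧ (p.2 : ℕ) < p.1 + K}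
  have haxis : axis.ncard ≤ strip.ncard := by
    refine Set.ncard_le_ncard_of_injOn _ ?_ injective_coe_prod.injOn
    rintro p ⟨hn, hK⟩
    simp only [strip, Finset.coe_product, Finset.coe_range, Set.mem_prod, Set.mem_Iio]
    omega
  have hdiag : diag.ncard ≤ strip.ncard := by
    refine Set.ncard_le_ncard_of_injOn (fun p => ((p.2 - p.1 : ℕ), (p.1 : ℕ))) ?_ ?_
    · rintro p ⟨hn, hle, hK⟩
      rw [← PNat.coe_le_coe] at hle
      simp only [strip, Finset.coe_product, Finset.coe_range, Set.mem_prod, Set.mem_Iio]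
      omega
    · rintro p ⟨-, hp, -⟩ q ⟨-, hq, -⟩ h
      simp only [Prod.mk.injEq, ← PNat.coe_le_coe] at h hp hq
      exact Prod.ext (PNat.eq (by omega)) (PNat.eq (by omega))
  calc (boundary K n).ncard = (axis ∪ diag).ncard := by
        simp only [boundary, axis, diag, and_or_left, Set.ofPred_or]
    _ ≤ axis.ncard + diag.ncard := Set.ncard_union_le _ _
    _ ≤ K * (n + 1) + K * (n + 1) := hstrip ▸ add_le_add haxis hdiag
    _ = 2 * K * (n + 1) := by ring

/-- The filtration of `S²(W₊)` by degree, where `e_p e_q` has degree `p + q`. -/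
noncomputable def degLE : ℕ →o Submodule k (SymSq k) where
  toFun n := monoSpan k (simplex n)
  monotone' _ _ h := Submodule.span_mono (Set.image_mono fun _ hp => le_trans hp h)

instance (n : ℕ) : Module.Finite k (degLE k n) := finite_monoSpan k (finite_simplex n)

instance (K n : ℕ) : Module.Finite k (monoSpan k (boundary K n)) :=
  finite_monoSpan k (finite_boundary K n)

theorem finrank_degLE_le (n : ℕ) : Module.finrank k (degLE k n) ≤ (n + 1) ^ 2 :=
  (finrank_monoSpan_le k (finite_simplex n)).trans (ncard_simplex_le n)

theorem finrank_monoSpan_boundary_le (K n : ℕ) :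
    Module.finrank k (monoSpan k (boundary K n)) ≤ 2 * K * (n + 1) :=
  (finrank_monoSpan_le k (finite_boundary K n)).trans (ncard_boundary_le K n)

variable {k} in
theorem mono_mem_degLE {p : ℕ+ × ℕ+} {n : ℕ} (hp : (p.1 + p.2 : ℕ) ≤ n) :
    mono k p ∈ degLE k n :=
  mono_mem_monoSpan (S := simplex n) hp

theorem iSup_degLE : ⨆ n, degLE k n = ⊤ := by
  rw [eq_top_iff, ← span_range_mono, Submodule.span_le]
  rintro _ ⟨p, rfl⟩
  exact Submodule.mem_iSup_of_mem (p.1 + p.2 : ℕ) (mono_mem_degLE le_rfl)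

theorem eU_mem_boundedDegree (i : ℕ+) : eU k i ∈ boundedDegree (Enveloping k) (degLE k) := by
  refine ⟨i, fun n x hx => ?_⟩
  induction hx using Submodule.span_induction with
  | mem x h =>
    obtain ⟨p, hp, rfl⟩ := h
    have hp : (p.1 + p.2 : ℕ) ≤ n := hp
    rw [eU_smul_mono]
    refine add_mem (Submodule.smul_mem _ _ (mono_mem_degLE ?_))
      (Submodule.smul_mem _ _ (mono_mem_degLE ?_)) <;>
    · simp only [PNat.add_coe]
      omega
  | zero => rw [smul_zero]; exact zero_mem _
  | add x y _ _ hx hy => rw [smul_add]; exact add_mem hx hy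
  | smul c x _ hx => rw [smul_comm]; exact Submodule.smul_mem _ c hx

attribute [local instance 100] LieRing.ofAssociativeRing in
theorem boundedDegree_degLE : boundedDegree (Enveloping k) (degLE k) = ⊤ := by
  rw [eq_top_iff, ← adjoin_range_ι, Algebra.adjoin_le_iff]
  have hspan : Submodule.span k (Set.range (e k)) ≤
      (Subalgebra.toSubmodule (boundedDegree (Enveloping k) (degLE k))).comap
        (UniversalEnvelopingAlgebra.ι k : PositiveWitt k →ₗ⁅k⁆ Enveloping k).toLinearMap := by
    rw [Submodule.span_le]
    rintro _ ⟨i, rfl⟩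
    exact eU_mem_boundedDegree k i
  rintro _ ⟨x, rfl⟩
  exact hspan ((e k).mem_span x)

theorem GKdim_symSq_le_two : GKdim k (Enveloping k) (SymSq k) ≤ 2 :=
  GKdim_le_of_filtration (C := 1) (r := 2) (boundedDegree_degLE k) (iSup_degLE k) fun n => by
    simpa only [one_mul] using finrank_degLE_le k n

variable {k}

theorem exists_degLE_le_quadSpan_sup_boundary [CharZero k] {f : SymSq k} (hf : f ≠ 0) :
    ∃ K, ∀ n, degLE k n ≤ quadSpan f n ⊔ monoSpan k (boundary K n) := by
  obtain ⟨g, hg, rfl⟩ := exists_symmetric_linearCombination_mono k f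
  have hg₀ : g ≠ 0 := by
    rintro rfl
    exact hf (map_zero _)
  obtain ⟨p₀, hp₀, hlead⟩ := exists_weight_lt_of_ne (Finsupp.support_nonempty_iff.2 hg₀)
  refine ⟨2 * (p₀.1 + p₀.2), fun n => Submodule.span_le.2 ?_⟩
  rintro _ ⟨p, hp, rfl⟩
  rcases le_total p.1 p.2 with hle | hle
  · exact mono_mem_quadSpan_sup_boundary hg hp₀ hlead hle hp
  · rw [← mono_swap]
    exact mono_mem_quadSpan_sup_boundary hg hp₀ hlead hle ((add_comm _ _).trans_le hp)

theorem GKdim_quotient_le_one [CharZero k] {N : Submodule (Enveloping k) (SymSq k)}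
    {f : SymSq k} (hfN : f ∈ N) (hf : f ≠ 0) : GKdim k (Enveloping k) (SymSq k ⧸ N) ≤ 1 := by
  obtain ⟨K, hK⟩ := exists_degLE_le_quadSpan_sup_boundary hf
  have hquad (n : ℕ) : quadSpan f n ≤ N.restrictScalars k := by
    refine Submodule.span_le.2 ?_
    rintro _ ⟨i, j, -, rfl⟩
    exact N.smul_mem _ (N.smul_mem _ hfN)
  have hgrowth (n : ℕ) : Module.finrank k (monoSpan k (boundary K n)) ≤ 2 * K * (n + 1) ^ 1 :=
    (finrank_monoSpan_boundary_le k K n).trans_eq (by rw [pow_one])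
  simpa only [Nat.cast_one] using
    GKdim_quotient_le_of_filtration (boundedDegree_degLE k) (iSup_degLE k) N
      (fun n => monoSpan k (boundary K n)) (fun n => (hK n).trans (sup_le_sup_right (hquad n) _))
      hgrowth

variable (k) in
/-- The span of the Lie algebra generators `e₁, e₂` of `W₊`. -/
noncomputable def genSpan : Submodule k (Enveloping k) := Submodule.span k {eU k 1, eU k 2}

attribute [local instance 100] LieRing.ofAssociativeRing in
theorem eU_mul_sub_mul (i j : ℕ+) :
    eU k i * eU k j - eU k j * eU k i = ((j : ℕ) - (i : ℕ) : k) • eU k (i + j) := by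
  rw [← LieRing.of_associative_ring_bracket, eU, eU, ← LieHom.map_lie, lie_e, map_smul]
  rfl

theorem eU_mem_pow [CharZero k] (i : ℕ+) : eU k i ∈ (1 ⊔ genSpan k) ^ (i : ℕ) := by
  have h₁ : eU k 1 ∈ 1 ⊔ genSpan k :=
    Submodule.mem_sup_right (Submodule.subset_span (Set.mem_insert _ _))
  have h₂ : eU k 2 ∈ 1 ⊔ genSpan k :=
    Submodule.mem_sup_right (Submodule.subset_span (Set.mem_insert_of_mem _ rfl))
  induction i using PNat.recOn with
  | one => rwa [PNat.one_coe, pow_one]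
  | succ i ih =>
    by_cases hi : i = 1
    · subst hi
      exact (le_self_pow₀ (le_sup_left : 1 ≤ 1 ⊔ genSpan k) (PNat.ne_zero _)) h₂
    · have hne : ((i : ℕ) - ((1 : ℕ+) : ℕ) : k) ≠ 0 :=
        sub_ne_zero.2 fun h => hi (PNat.eq (Nat.cast_injective h))
      rw [← Submodule.smul_mem_iff _ hne, add_comm i 1, ← eU_mul_sub_mul, add_comm 1 i,
        PNat.add_coe, PNat.one_coe]
      refine sub_mem ?_ ?_
      · rw [pow_succ']
        exact Submodule.mul_mem_mul h₁ ih
      · rw [pow_succ]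
        exact Submodule.mul_mem_mul ih h₁

theorem quadSpan_le_pow_smul [CharZero k] (f : SymSq k) (n : ℕ) :
    quadSpan f n ≤ (1 ⊔ genSpan k) ^ n • Submodule.span k {f} := by
  refine Submodule.span_le.2 ?_
  rintro _ ⟨i, j, h, rfl⟩
  have hmul : eU k i * eU k j ∈ (1 ⊔ genSpan k) ^ (i + j : ℕ) := by
    rw [pow_add]
    exact Submodule.mul_mem_mul (eU_mem_pow i) (eU_mem_pow j)
  rw [SetLike.mem_coe, ← mul_smul]
  exact Submodule.smul_mem_smul (pow_le_pow_right₀ (le_sup_left : 1 ≤ 1 ⊔ genSpan k) h hmul)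
    (Submodule.mem_span_singleton_self f)

theorem sq_le_finrank_degLE {m n : ℕ} (h : 3 * m ≤ n) :
    m ^ 2 ≤ Module.finrank k (degLE k n) := by
  let square (x : Fin m × Fin m) : ℕ+ × ℕ+ := ((x.1 : ℕ).succPNat, (m + x.2 : ℕ).succPNat)
  have hinj : Function.Injective fun x => s((square x).1, (square x).2) := by
    rintro ⟨⟨a, ha⟩, ⟨b, hb⟩⟩ ⟨⟨c, hc⟩, ⟨d, hd⟩⟩ h
    simp only [square, Sym2.eq_iff, Nat.succPNat_inj] at h
    simp only [Prod.mk.injEq, Fin.mk.injEq]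
    omega
  have hli : LinearIndependent k fun x => mono k (square x) :=
    linearIndependent_mono_comp k hinj
  have hmem (x : Fin m × Fin m) : mono k (square x) ∈ degLE k n := by
    refine mono_mem_degLE ?_
    simp only [square, Nat.succPNat_coe]
    omega
  have hcard := (LinearIndependent.of_comp (v := fun x => (⟨_, hmem x⟩ : degLE k n))
    (degLE k n).subtype hli).fintype_card_le_finrank
  rwa [Fintype.card_prod, Fintype.card_fin, ← pow_two] at hcard

theorem two_le_GKdim_symSq [CharZero k] : 2 ≤ GKdim k (Enveloping k) (SymSq k) := by
  let f : SymSq k := mono k (1, 1)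
  have hf : f ≠ 0 := (linearIndependent_quadMonomial (e k)).ne_zero s(1, 1)
  obtain ⟨K, hK⟩ := exists_degLE_le_quadSpan_sup_boundary hf
  have hone : (1 : Submodule k (Enveloping k)).FG := by
    rw [Submodule.one_eq_span]
    exact Submodule.fg_span (Set.finite_singleton _)
  have hV : (genSpan k).FG := Submodule.fg_span (Set.toFinite _)
  have hF : (Submodule.span k {f}).FG := Submodule.fg_span (Set.finite_singleton _)
  refine le_GKdim (C := 32) (r := 2) hV hF ?_
  filter_upwards [Filter.eventually_ge_atTop (256 * (K + 1))] with n hn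
  let W : Submodule k (SymSq k) := (1 ⊔ genSpan k) ^ n • Submodule.span k {f}
  have hW : Module.Finite k W := Module.Finite.iff_fg.2
    (fg_smul ((hone.sup hV).pow n) hF)
  have hlower : (n / 3) ^ 2 ≤ Module.finrank k W + 2 * K * (n + 1) :=
    calc (n / 3) ^ 2 ≤ Module.finrank k (degLE k n) := sq_le_finrank_degLE (Nat.mul_div_le n 3)
      _ ≤ Module.finrank k (W ⊔ monoSpan k (boundary K n) : Submodule k (SymSq k)) :=
        Submodule.finrank_mono ((hK n).trans (sup_le_sup_right (quadSpan_le_pow_smul f n) _))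
      _ ≤ Module.finrank k W + Module.finrank k (monoSpan k (boundary K n)) :=
        Submodule.finrank_add_le_finrank_add_finrank _ _
      _ ≤ Module.finrank k W + 2 * K * (n + 1) := by
        gcongr
        exact finrank_monoSpan_boundary_le k K n
  have hthird : n ≤ 4 * (n / 3) := by omega
  change n ^ 2 ≤ 32 * Module.finrank k W
  nlinarith

end PositiveWitt

theorem corollary4p10 (k : Type*) [Field k] [CharZero k] :
    IsGKCritical k (UniversalEnvelopingAlgebra k (PositiveWitt k))
      (LieSymmetric.SymPower k (PositiveWitt k) 2) 2 ∧
    ∀ f : LieSymmetric.SymPower k (PositiveWitt k) 2, f ≠ 0 →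
      GKdim k (UniversalEnvelopingAlgebra k (PositiveWitt k))
        (LieSymmetric.SymPower k (PositiveWitt k) 2 ⧸
          Submodule.span (UniversalEnvelopingAlgebra k (PositiveWitt k)) {f}) ≤ 1 := by
  refine ⟨⟨le_antisymm (PositiveWitt.GKdim_symSq_le_two k) PositiveWitt.two_le_GKdim_symSq,
    fun N hN => ?_⟩, fun f hf => ?_⟩
  · obtain ⟨f, hfN, hf⟩ := N.ne_bot_iff.1 hN
    refine (PositiveWitt.GKdim_quotient_le_one hfN hf).trans_lt ?_
    exact_mod_cast (one_lt_two : (1 : ℝ) < 2)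
  · exact PositiveWitt.GKdim_quotient_le_one (Submodule.mem_span_singleton_self f) hf
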